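/- Let $d \in \mathbb N_0$ and write $X=(x,\xi)$, $Y=(y,\eta)$, $Z=(z,\zeta)$ for points of phase space $\Xi := \mathbb R^d_x\times\mathbb R^d_\xi$, and $\sigma(X,Y) := \xi\cdot y - x\cdot\eta$. For $f\in\mathcal S(\Xi)$ let $$(\mathcal F_\sigma f)(X) := \frac{1}{(2\pi)^d}\int_\Xi dY\, e^{i\sigma(X,Y)} f(Y).$$ For $0<\varepsilon<1$ and $\varphi:\mathbb R^d\to\mathbb C$ let $W_\varepsilon(Y)$ be the Weyl system $$(W_\varepsilon(Y)\varphi)(x) := e^{-i\eta\cdot(x+\frac{\varepsilon}{2}y)}\,\varphi(x+\varepsilon y),$$ i.e. $W_\varepsilon(Y) = e^{-i(\eta\cdot Q - y\cdot P)}$ with $Q = x$, $P = -i\varepsilon\nabla_x$, and let $$\mathrm{Op}_\varepsilon(f)\varphi := \frac{1}{(2\pi)^d}\int_\Xi dX\,(\mathcal F_\sigma f)(X)\,W_\varepsilon(X)\varphi$$ be the Weyl quantization of $f$. Theorem. Let $f,g\in\mathcal S(\Xi)$. For every $\varepsilon\in(0,1)$ there is exactly one $f\sharp g = f\sharp_\varepsilon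 g\in\mathcal S(\Xi)$ (the Weyl product) with $\mathrm{Op}_\varepsilon(f\sharp g)\varphi = \mathrm{Op}_\varepsilon(f)\,\mathrm{Op}_\varepsilon(g)\varphi$ for all $\varphi\in\mathcal S(\mathbb R^d)$, and for every $N\in\mathbb N_0$ $$f\sharp g = \sum_{n=0}^N \varepsilon^n (f\sharp g)_{(n)} + \varepsilon^{N+1} R_N = \sum_{n=0}^N \varepsilon^n (f\sharp g)_{(n)} + \mathcal O(\varepsilon^{N+1}).$$ Here the terms $(f\sharp g)_{(n)}$, which do not depend on $\varepsilon$, are for all $n\in\mathbb N_0$ the Schwartz functions $$(f\sharp g)_{(n)}(X) = \frac{1}{n!}\Bigl(\frac i2\Bigr)^n\bigl(\nabla_y\cdot\nabla_\zeta-\nabla_\eta\cdot\nabla_z\bigr)^n f(Y)\,g(Z)\Big|_{Y=X=Z},$$ and the remainder $R_N = R_N(\varepsilon)$ is the Schwartz function $$R_N(X) = \frac{1}{(2\pi)^{2d}}\int_\Xi dY\int_\Xi dZ\; e^{i\sigma(X,Y+Z)}\,\frac{1}{N!}\Bigl(\frac i2\Bigr)^{N+1}\sigma(Y,Z)^{N+1}\left(\int_0^1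 ds\,(1-s)^N e^{is\frac{\varepsilon}{2}\sigma(Y,Z)}\right)(\mathcal F_\sigma f)(Y)\,(\mathcal F_\sigma g)(Z).$$ The symbol $\mathcal O(\varepsilon^k)$ is meant in $\mathcal S(\Xi)$: each Schwartz seminorm of the error is at most $C\varepsilon^k$ for all $\varepsilon\in(0,1)$, where $C$ may depend on the seminorm, on $f$, $g$, $d$ and on $N$, but not on $\varepsilon$. In particular, $$f\sharp g = fg - \varepsilon\,\tfrac i2\,\{f,g\} + \mathcal O(\varepsilon^2),\qquad \{f,g\} = \sum_{j=1}^d\bigl(\partial_{\xi_j}f\,\partial_{x_j}g-\partial_{x_j}f\,\partial_{\xi_j}g\bigr).$$ -/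

import Mathlib

open scoped SchwartzMap

noncomputable section

namespace WeylCalculus

/-- Configuration space `ℝ^d` (also used for momenta). -/
abbrev Config (d : ℕ) : Type := EuclideanSpace ℝ (Fin d)

/-- Phase space `ℝ^d_x × ℝ^d_ξ`; a point is `X = (x, ξ)`. -/
abbrev Phase (d : ℕ) : Type := Config d × Config d

/-- The symplectic form `σ(X, Y) = ξ · y - x · η` for `X = (x, ξ)`, `Y = (y, η)`. -/
def sympl {d : ℕ} (X Y : Phase d) : ℝ :=
  inner ℝ X.2 Y.1 - inner ℝ X.1 Y.2

/-- The symplectic Fourier transform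
`(F f)(X) = (2π)^{-d} ∫ e^{i σ(X, Y)} f(Y) dY`. -/
def symplFourier {d : ℕ} (f : Phase d → ℂ) (X : Phase d) : ℂ :=
  ((2 * (Real.pi : ℂ)) ^ d)⁻¹ *
    ∫ Y : Phase d, Complex.exp (Complex.I * (sympl X Y : ℂ)) * f Y

/-- The Weyl system `W(Y) = e^{-i (η · Q - y · P)}` with `Q = x`, `P = -i ε ∇_x`, `Y = (y, η)`:
`(W(Y) φ)(x) = e^{-i η · (x + (ε/2) y)} φ(x + ε y)`. -/
def weylSystem {d : ℕ} (ε : ℝ) (Y : Phase d) (φ : Config d → ℂ) (x : Config d) : ℂ :=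
  Complex.exp (-(Complex.I * (inner ℝ Y.2 (x + (ε / 2) • Y.1) : ℝ))) * φ (x + ε • Y.1)

/-- Weyl quantization `Op(f) φ = (2π)^{-d} ∫ (F f)(X) W(X) φ dX`. -/
def weylOp {d : ℕ} (ε : ℝ) (f : Phase d → ℂ) (φ : Config d → ℂ) (x : Config d) : ℂ :=
  ((2 * (Real.pi : ℂ)) ^ d)⁻¹ *
    ∫ X : Phase d, symplFourier f X * weylSystem ε X φ x

/-- `h` is the Weyl product `f ♯ g`, that is, `Op(h) = Op(f) Op(g)` (tested on the dense subspace
of Schwartz functions). -/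
def IsWeylProduct {d : ℕ} (ε : ℝ) (f g h : 𝓢(Phase d, ℂ)) : Prop :=
  ∀ φ : 𝓢(Config d, ℂ), weylOp ε h φ = weylOp ε f (weylOp ε g φ)

/-- The phase space vector in the direction of the position coordinate `x_j`. -/
def posDir {d : ℕ} (j : Fin d) : Phase d := (EuclideanSpace.single j 1, 0)

/-- The phase space vector in the direction of the momentum coordinate `ξ_j`. -/
def momDir {d : ℕ} (j : Fin d) : Phase d := (0, EuclideanSpace.single j 1)

/-- The derivative of `F` in the direction of the constant vector `v`. -/
def dirDeriv {E : Type*} [NormedAddCommGroup E] [NormedSpace ℝ E] (v : E) (F : E → ℂ) (p : E) : ℂ :=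
  fderiv ℝ F p v

/-- The bidifferential operator `∇_y · ∇_ζ - ∇_η · ∇_z` acting on functions of
`(Y, Z) = ((y, η), (z, ζ))`. -/
def biDiff {d : ℕ} (F : Phase d × Phase d → ℂ) (p : Phase d × Phase d) : ℂ :=
  ∑ j : Fin d,
    (dirDeriv ((posDir j, 0) : Phase d × Phase d)
        (dirDeriv ((0, momDir j) : Phase d × Phase d) F) p
      - dirDeriv ((momDir j, 0) : Phase d × Phase d)
        (dirDeriv ((0, posDir j) : Phase d × Phase d) F) p)

/-- The `n`-th order term
`(1/n!) (i/2)^n (∇_y · ∇_ζ - ∇_η · ∇_z)^n f(Y) g(Z)` at `Y = X = Z`. -/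
def weylTerm {d : ℕ} (n : ℕ) (f g : Phase d → ℂ) (X : Phase d) : ℂ :=
  ((n.factorial : ℂ))⁻¹ * (Complex.I / 2) ^ n *
    (biDiff^[n] (fun p : Phase d × Phase d => f p.1 * g p.2)) (X, X)

/-- The remainder `R_N`, obtained by replacing the twisting factor `e^{i (ε/2) σ(Y, Z)}` in the
integral for the Weyl product by `ε^{-(N+1)}` times its `N`-th order Taylor remainder. -/
def weylRemainder {d : ℕ} (N : ℕ) (ε : ℝ) (f g : Phase d → ℂ) (X : Phase d) : ℂ :=
  ((2 * (Real.pi : ℂ)) ^ (2 * d))⁻¹ *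
    ∫ Y : Phase d, ∫ Z : Phase d,
      Complex.exp (Complex.I * (sympl X (Y + Z) : ℂ)) *
        (((N.factorial : ℂ))⁻¹ * (Complex.I / 2) ^ (N + 1) * (sympl Y Z : ℂ) ^ (N + 1) *
          ∫ s in (0 : ℝ)..1,
            ((1 - s : ℝ) : ℂ) ^ N * Complex.exp (Complex.I * ((s * (ε / 2) * sympl Y Z : ℝ) : ℂ))) *
        symplFourier f Y * symplFourier g Z

/-- The Poisson bracket `{f, g} = ∑_j (∂_{ξ_j} f ∂_{x_j} g - ∂_{x_j} f ∂_{ξ_j} g)`. -/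
def poisson {d : ℕ} (f g : Phase d → ℂ) (X : Phase d) : ℂ :=
  ∑ j : Fin d,
    (dirDeriv (momDir j) f X * dirDeriv (posDir j) g X
      - dirDeriv (posDir j) f X * dirDeriv (momDir j) g X)

/-- The family `F ε` is `O(ε^k)` in the Schwartz space: each Schwartz seminorm of `F ε` is bounded
by a constant times `ε^k`, uniformly for `0 < ε < 1`. -/
def IsOrder {d : ℕ} (k : ℕ) (F : ℝ → 𝓢(Phase d, ℂ)) : Prop :=
  ∀ a b : ℕ, ∃ C : ℝ, ∀ ε ∈ Set.Ioo (0 : ℝ) 1, SchwartzMap.seminorm ℝ a b (F ε) ≤ C * ε ^ k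

end WeylCalculus

end

open scoped ContDiff FourierTransform
open MeasureTheory

noncomputable section

/-! ### Schwartz functions on products and oscillatory integral transforms -/

namespace SchwartzMap

variable {D E F : Type*} [NormedAddCommGroup D] [NormedSpace ℝ D]
  [NormedAddCommGroup E] [NormedSpace ℝ E] [NormedAddCommGroup F] [NormedSpace ℝ F]

/-! Weyl operators compose by W(Y) W(Z) = e^{i(ε/2)σ(Y,Z)} W(Y+Z) (`weylSystem_weylSystem`). By
Fubini, Op(f) Op(g) therefore integrates W against a twisted convolution of the symplectic Fourier
transforms of f and g. The symplectic Fourier transform is an involution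
(`symplFourier_symplFourier`), so f ♯ g is the transform of that convolution: (f ♯ g)(X) =
(2π)^{-2d} ∫∫ e^{iσ(X,Y+Z)} e^{i(ε/2)σ(Y,Z)} Ff(Y) Fg(Z) dY dZ.

The expansion is Taylor's formula with integral remainder for the twisting factor
(`exp_eq_sum_add_expTaylorKernel`). Under the double Fourier integral each application of `biDiff`
multiplies by σ(Y,Z) (`pairSympl_eq_sum`), which identifies the terms.

For uniformity of the remainder, ε is treated as one more variable: the remainder symbol times a
cutoff in ε is Schwartz on ℝ × Ξ × Ξ. Its slices form a bounded set, and the continuous linear map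
`diagonalCLM` keeps it bounded.

Uniqueness is injectivity of the quantization. Testing on all Schwartz φ at a fixed x kills a
partial Fourier transform of Ff in the momentum variable; as x varies, Fourier inversion kills Ff
itself. -/

theorem norm_iteratedFDeriv_comp_prodMk_le {G : D × E → F} (hG : ContDiff ℝ ∞ G) (t : D) (n : ℕ)
    (q : E) :
    ‖iteratedFDeriv ℝ n (fun q => G (t, q)) q‖ ≤ ‖iteratedFDeriv ℝ n G (t, q)‖ := by
  have h1 : (fun q => G (t, q))
      = (fun p => G ((t, 0) + p)) ∘ (ContinuousLinearMap.inr ℝ D E) := by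
    ext q; simp
  have hG' : ContDiff ℝ ∞ (fun p => G ((t, 0) + p)) := hG.comp (contDiff_const.add contDiff_id)
  rw [h1, ContinuousLinearMap.iteratedFDeriv_comp_right _ hG' q (i := n) (mod_cast le_top),
    iteratedFDeriv_comp_add_left]
  refine (ContinuousMultilinearMap.norm_compContinuousLinearMap_le _ _).trans ?_
  have h2 : (t, (0 : E)) + ContinuousLinearMap.inr ℝ D E q = (t, q) := by simp
  rw [h2]
  refine mul_le_of_le_one_right (norm_nonneg _) (Finset.prod_le_one (fun _ _ => norm_nonneg _) ?_)
  exact fun _ _ => ContinuousLinearMap.norm_inr_le_one ℝ D E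

theorem pow_mul_norm_iteratedFDeriv_comp_prodMk_le (G : 𝓢(D × E, F)) (t : D) (k n : ℕ) (q : E) :
    ‖q‖ ^ k * ‖iteratedFDeriv ℝ n (fun q => G (t, q)) q‖ ≤ SchwartzMap.seminorm ℝ k n G := by
  refine le_trans ?_ (le_seminorm ℝ k n G (t, q))
  gcongr
  · exact norm_snd_le (t, q)
  · exact norm_iteratedFDeriv_comp_prodMk_le (G.smooth ⊤) t n q

/-- The restriction of a Schwartz function on a product to `{t} × E`. -/
def slice (t : D) (G : 𝓢(D × E, F)) : 𝓢(E, F) where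
  toFun q := G (t, q)
  smooth' := (G.smooth ⊤).comp (contDiff_const.prodMk contDiff_id)
  decay' k n := ⟨_, pow_mul_norm_iteratedFDeriv_comp_prodMk_le G t k n⟩

@[simp]
theorem slice_apply (t : D) (G : 𝓢(D × E, F)) (q : E) : slice t G q = G (t, q) := rfl

theorem seminorm_slice_le (t : D) (G : 𝓢(D × E, F)) (k n : ℕ) :
    SchwartzMap.seminorm ℝ k n (slice t G) ≤ SchwartzMap.seminorm ℝ k n G :=
  seminorm_le_bound ℝ k n _ (apply_nonneg _ _) (pow_mul_norm_iteratedFDeriv_comp_prodMk_le G t k n)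

theorem norm_iteratedFDeriv_comp_fst_le {f : D → F} (hf : ContDiff ℝ ∞ f) (n : ℕ) (p : D × E) :
    ‖iteratedFDeriv ℝ n (fun p : D × E => f p.1) p‖ ≤ ‖iteratedFDeriv ℝ n f p.1‖ := by
  have h1 : (fun p : D × E => f p.1) = f ∘ ContinuousLinearMap.fst ℝ D E := rfl
  rw [h1, ContinuousLinearMap.iteratedFDeriv_comp_right _ hf p (i := n) (mod_cast le_top)]
  refine (ContinuousMultilinearMap.norm_compContinuousLinearMap_le _ _).trans ?_
  refine mul_le_of_le_one_right (norm_nonneg _) (Finset.prod_le_one (fun _ _ => norm_nonneg _) ?_)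
  exact fun _ _ => ContinuousLinearMap.norm_fst_le ℝ D E

theorem norm_iteratedFDeriv_comp_snd_le {f : E → F} (hf : ContDiff ℝ ∞ f) (n : ℕ) (p : D × E) :
    ‖iteratedFDeriv ℝ n (fun p : D × E => f p.2) p‖ ≤ ‖iteratedFDeriv ℝ n f p.2‖ := by
  have h1 : (fun p : D × E => f p.2) = f ∘ ContinuousLinearMap.snd ℝ D E := rfl
  rw [h1, ContinuousLinearMap.iteratedFDeriv_comp_right _ hf p (i := n) (mod_cast le_top)]
  refine (ContinuousMultilinearMap.norm_compContinuousLinearMap_le _ _).trans ?_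
  refine mul_le_of_le_one_right (norm_nonneg _) (Finset.prod_le_one (fun _ _ => norm_nonneg _) ?_)
  exact fun _ _ => ContinuousLinearMap.norm_snd_le ℝ D E

/-- The tensor product `(x, y) ↦ f x * g y` of two Schwartz functions. -/
def tensor (f : 𝓢(D, ℂ)) (g : 𝓢(E, ℂ)) : 𝓢(D × E, ℂ) where
  toFun p := f p.1 * g p.2
  smooth' := ((f.smooth ⊤).comp contDiff_fst).mul ((g.smooth ⊤).comp contDiff_snd)
  decay' k n := by
    let s := SchwartzMap.seminorm ℝ (E := D) (F := ℂ)
    let s' := SchwartzMap.seminorm ℝ (E := E) (F := ℂ)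
    refine ⟨∑ i ∈ Finset.range (n + 1),
      (n.choose i : ℝ) * (s k i f * s' 0 (n - i) g + s 0 i f * s' k (n - i) g), fun p => ?_⟩
    have hf : ContDiff ℝ ∞ (fun p : D × E => f p.1) := (f.smooth ⊤).comp contDiff_fst
    have hg : ContDiff ℝ ∞ (fun p : D × E => g p.2) := (g.smooth ⊤).comp contDiff_snd
    have h1 := norm_iteratedFDeriv_mul_le (𝕜 := ℝ) hf hg p (n := n) (mod_cast le_top)
    refine (mul_le_mul_of_nonneg_left h1 (by positivity)).trans ?_
    rw [Finset.mul_sum]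
    refine Finset.sum_le_sum fun i _ => ?_
    -- The norm on the product is a maximum, so the weight can be moved onto one factor at a time.
    have hp : ‖p‖ ^ k ≤ ‖p.1‖ ^ k + ‖p.2‖ ^ k := by
      rw [Prod.norm_def]
      rcases max_cases ‖p.1‖ ‖p.2‖ with h | h <;> rw [h.1]
      · exact le_add_of_nonneg_right (by positivity)
      · exact le_add_of_nonneg_left (by positivity)
    have a1 := norm_iteratedFDeriv_comp_fst_le (E := E) (f.smooth ⊤) i p
    have a2 := norm_iteratedFDeriv_comp_snd_le (D := D) (g.smooth ⊤) (n - i) p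
    have b1 : ‖p.1‖ ^ k * ‖iteratedFDeriv ℝ i f p.1‖ ≤ s k i f := le_seminorm ℝ k i f p.1
    have b2 : ‖p.2‖ ^ k * ‖iteratedFDeriv ℝ (n - i) g p.2‖ ≤ s' k (n - i) g :=
      le_seminorm ℝ k (n - i) g p.2
    have b3 : ‖iteratedFDeriv ℝ i f p.1‖ ≤ s 0 i f := norm_iteratedFDeriv_le_seminorm ℝ f i p.1
    have b4 : ‖iteratedFDeriv ℝ (n - i) g p.2‖ ≤ s' 0 (n - i) g :=
      norm_iteratedFDeriv_le_seminorm ℝ g (n - i) p.2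
    calc ‖p‖ ^ k * (n.choose i * ‖iteratedFDeriv ℝ i (fun p : D × E => f p.1) p‖
          * ‖iteratedFDeriv ℝ (n - i) (fun p : D × E => g p.2) p‖)
        ≤ (‖p.1‖ ^ k + ‖p.2‖ ^ k) * (n.choose i * ‖iteratedFDeriv ℝ i f p.1‖
          * ‖iteratedFDeriv ℝ (n - i) g p.2‖) := by gcongr
      _ = n.choose i * ((‖p.1‖ ^ k * ‖iteratedFDeriv ℝ i f p.1‖) *
            ‖iteratedFDeriv ℝ (n - i) g p.2‖ + ‖iteratedFDeriv ℝ i f p.1‖ *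
            (‖p.2‖ ^ k * ‖iteratedFDeriv ℝ (n - i) g p.2‖)) := by ring
      _ ≤ _ := by
        gcongr

@[simp]
theorem tensor_apply (f : 𝓢(D, ℂ)) (g : 𝓢(E, ℂ)) (p : D × E) : tensor f g p = f p.1 * g p.2 := rfl

/-- A real bilinear form without kernel on the left gives an oscillatory integral transform of
Schwartz functions. -/
theorem exists_oscillatoryCLM [FiniteDimensional ℝ D] [FiniteDimensional ℝ E] [MeasurableSpace E]
    [BorelSpace E] (μ : Measure E) [μ.IsAddHaarMeasure] (B : D →L[ℝ] E →L[ℝ] ℝ)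
    (hB : Function.Injective B) :
    ∃ T : 𝓢(E, ℂ) →L[ℂ] 𝓢(D, ℂ), ∀ (f : 𝓢(E, ℂ)) (X : D),
      T f X = ∫ q, Complex.exp (Complex.I * (B X q : ℂ)) * f q ∂μ := by
  let V := EuclideanSpace ℝ (Fin (Module.finrank ℝ E))
  let e : V ≃L[ℝ] E := toEuclidean.symm
  -- Riesz representation of -B/(2π): the kernel e^{-2πi⟨v, A X⟩} of the Fourier transform on V
  -- becomes e^{iB(X, e v)}. Injectivity and finite dimension make A antilipschitz, so composing
  -- with A preserves Schwartz decay.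
  let A : D →ₗ[ℝ] V :=
    { toFun := fun X => -((2 * Real.pi)⁻¹ : ℝ) •
        (InnerProductSpace.toDual ℝ V).symm ((B X).comp (e : V →L[ℝ] E))
      map_add' := fun X Y => by simp [ContinuousLinearMap.add_comp]
      map_smul' := fun r X => by simp [ContinuousLinearMap.smul_comp, smul_smul, mul_comm] }
  have hA (X : D) (v : V) : inner ℝ (A X) v = -((2 * Real.pi)⁻¹ : ℝ) * B X (e v) := by
    simp only [A, LinearMap.coe_mk, AddHom.coe_mk]
    rw [inner_smul_left, InnerProductSpace.toDual_symm_apply]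
    simp
  have hker : LinearMap.ker A = ⊥ := by
    rw [LinearMap.ker_eq_bot']
    intro X hX
    apply hB
    ext q
    have h := hA X (e.symm q)
    rw [hX] at h
    simpa [Real.pi_ne_zero] using h.symm
  obtain ⟨K, -, hK⟩ := A.exists_antilipschitzWith hker
  let A' : D →L[ℝ] V := LinearMap.toContinuousLinearMap A
  -- By uniqueness of Haar measure, transporting μ to V costs only a constant.
  have hmeas : ∃ c : ℝ, ∀ f : E → ℂ, ∫ q, f q ∂μ = c • ∫ v, f (e v) := by
    have : (μ.map e.symm).IsAddHaarMeasure := e.symm.isAddHaarMeasure_map μ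
    let c := Measure.addHaarScalarFactor (μ.map e.symm) (volume : Measure V)
    refine ⟨c, fun f => ?_⟩
    have h1 : ∫ v, f (e v) ∂(μ.map e.symm) = ∫ q, f q ∂μ := by
      have := (e.symm.toHomeomorph.measurableEmbedding).integral_map (μ := μ) (fun v => f (e v))
      simpa using this
    rw [← h1, Measure.isAddLeftInvariant_eq_smul (μ.map e.symm) (volume : Measure V)]
    rw [integral_smul_nnreal_measure]
    rfl
  obtain ⟨c, hc⟩ := hmeas
  refine ⟨(c : ℂ) • (compCLMOfAntilipschitz ℂ A'.hasTemperateGrowth hK ∘L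
    FourierTransform.fourierCLM ℂ 𝓢(V, ℂ) ∘L compCLMOfContinuousLinearEquiv ℂ e), fun f X => ?_⟩
  rw [hc]
  have : (((c : ℂ) • (compCLMOfAntilipschitz ℂ A'.hasTemperateGrowth hK ∘L
    FourierTransform.fourierCLM ℂ 𝓢(V, ℂ) ∘L compCLMOfContinuousLinearEquiv ℂ e)) f) X =
    c • 𝓕 (f ∘ e) (A X) := by
      simp
      exact Or.inl rfl
  rw [this, Real.fourier_eq']
  congr 2
  ext v
  rw [real_inner_comm, hA]
  simp only [smul_eq_mul, Function.comp]
  congr 2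
  push_cast
  field_simp

end SchwartzMap

/-! ### Taylor's formula for the exponential with a kernel of temperate growth -/

/-- The integral `∫_0^1 w(s) e^{i s θ} ds`. -/
def unitFourier (w : ℝ → ℂ) (θ : ℝ) : ℂ :=
  ∫ s in (0 : ℝ)..1, w s * Complex.exp (Complex.I * ((s * θ : ℝ) : ℂ))

theorem hasDerivAt_unitFourier {w : ℝ → ℂ} (hw : Continuous w) (θ : ℝ) :
    HasDerivAt (unitFourier w) (unitFourier (fun s => w s * (Complex.I * s)) θ) θ := by
  refine (intervalIntegral.hasDerivAt_integral_of_dominated_loc_of_deriv_le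
    (F := fun θ s => w s * Complex.exp (Complex.I * ((s * θ : ℝ) : ℂ)))
    (F' := fun θ s => w s * (Complex.I * s) * Complex.exp (Complex.I * ((s * θ : ℝ) : ℂ)))
    (s := Set.univ) (bound := fun s => ‖w s‖ * ‖s‖) Filter.univ_mem ?_ ?_ ?_ ?_ ?_ ?_).2
  · exact .of_forall fun x => (by fun_prop : Continuous _).aestronglyMeasurable
  · exact (by fun_prop : Continuous _).intervalIntegrable _ _
  · exact (by fun_prop : Continuous _).aestronglyMeasurable
  · refine .of_forall fun s _ x _ => ?_
    rw [mul_comm Complex.I (((s * x : ℝ) : ℂ)), norm_mul, Complex.norm_exp_ofReal_mul_I]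
    simp
  · exact (by fun_prop : Continuous _).intervalIntegrable _ _
  · refine .of_forall fun s _ x _ => ?_
    have h1 : HasDerivAt (fun x : ℝ => Complex.I * ((s * x : ℝ) : ℂ)) (Complex.I * s) x := by
      have := (((hasDerivAt_id x).const_mul s).ofReal_comp).const_mul Complex.I
      simpa using this
    refine (h1.cexp.const_mul (w s)).congr_deriv ?_
    ring

theorem iteratedDeriv_unitFourier (n : ℕ) {w : ℝ → ℂ} (hw : Continuous w) :
    iteratedDeriv n (unitFourier w) = unitFourier (fun s => w s * (Complex.I * s) ^ n) := by
  induction n with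
  | zero => simp
  | succ n ih =>
    rw [iteratedDeriv_succ, ih]
    ext θ
    rw [(hasDerivAt_unitFourier (by fun_prop) θ).deriv]
    simp only [pow_succ, mul_assoc]

theorem norm_unitFourier_le {w : ℝ → ℂ} (θ : ℝ) :
    ‖unitFourier w θ‖ ≤ ∫ s in (0 : ℝ)..1, ‖w s‖ := by
  refine (intervalIntegral.norm_integral_le_integral_norm zero_le_one).trans (le_of_eq ?_)
  congr 1
  ext s
  rw [mul_comm Complex.I (((s * θ : ℝ) : ℂ)), norm_mul, Complex.norm_exp_ofReal_mul_I, mul_one]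

/-- Each derivative only inserts a power of is, with s in [0, 1], so all derivatives are bounded. -/
theorem hasTemperateGrowth_unitFourier {w : ℝ → ℂ} (hw : Continuous w) :
    (unitFourier w).HasTemperateGrowth := by
  refine ⟨contDiff_of_differentiable_iteratedDeriv fun n _ => ?_, fun n => ?_⟩
  · rw [iteratedDeriv_unitFourier n hw]
    exact fun θ => (hasDerivAt_unitFourier (by fun_prop) θ).differentiableAt
  · refine ⟨0, ∫ s in (0 : ℝ)..1, ‖w s * (Complex.I * s) ^ n‖, fun θ => ?_⟩
    rw [norm_iteratedFDeriv_eq_norm_iteratedDeriv, iteratedDeriv_unitFourier n hw, pow_zero,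
      mul_one]
    exact norm_unitFourier_le θ

/-- The kernel `∫_0^1 (1 - s)^N e^{i s θ} ds` of the Taylor remainder of the exponential. -/
def expTaylorKernel (N : ℕ) : ℝ → ℂ := unitFourier (fun s => ((1 - s : ℝ) : ℂ) ^ N)

theorem hasTemperateGrowth_expTaylorKernel (N : ℕ) : (expTaylorKernel N).HasTemperateGrowth :=
  hasTemperateGrowth_unitFourier (by fun_prop)

theorem hasDerivAt_exp_I_mul (θ s : ℝ) :
    HasDerivAt (fun s : ℝ => Complex.exp (Complex.I * ((s * θ : ℝ) : ℂ)))
      (Complex.I * θ * Complex.exp (Complex.I * ((s * θ : ℝ) : ℂ))) s := by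
  have h1 : HasDerivAt (fun s : ℝ => Complex.I * ((s * θ : ℝ) : ℂ)) (Complex.I * θ) s := by
    have := (((hasDerivAt_id s).mul_const θ).ofReal_comp).const_mul Complex.I
    simpa using this
  exact h1.cexp.congr_deriv (by ring)

theorem expTaylorKernel_zero (θ : ℝ) :
    Complex.I * θ * expTaylorKernel 0 θ = Complex.exp (Complex.I * θ) - 1 := by
  have := intervalIntegral.integral_eq_sub_of_hasDerivAt
    (fun s _ => hasDerivAt_exp_I_mul θ s)
    ((by fun_prop : Continuous _).intervalIntegrable (0 : ℝ) 1)
  rw [intervalIntegral.integral_const_mul] at this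
  simpa [expTaylorKernel, unitFourier] using this

/-- Integration by parts; the boundary term vanishes at s = 1 and gives -1 from s = 0. -/
theorem expTaylorKernel_succ (N : ℕ) (θ : ℝ) :
    Complex.I * θ * expTaylorKernel (N + 1) θ = (N + 1) * expTaylorKernel N θ - 1 := by
  have hd (s : ℝ) : HasDerivAt (fun s : ℝ => ((1 - s : ℝ) : ℂ) ^ (N + 1)
      * Complex.exp (Complex.I * ((s * θ : ℝ) : ℂ)))
      (Complex.I * θ * (((1 - s : ℝ) : ℂ) ^ (N + 1) * Complex.exp (Complex.I * ((s * θ : ℝ) : ℂ)))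
        - (N + 1) * (((1 - s : ℝ) : ℂ) ^ N * Complex.exp (Complex.I * ((s * θ : ℝ) : ℂ)))) s := by
    have h1 : HasDerivAt (fun s : ℝ => ((1 - s : ℝ) : ℂ)) (-1) s := by
      simpa using ((hasDerivAt_id s).const_sub 1).ofReal_comp
    refine ((h1.fun_pow (N + 1)).fun_mul (hasDerivAt_exp_I_mul θ s)).congr_deriv ?_
    push_cast [Nat.add_sub_cancel]
    ring
  have := intervalIntegral.integral_eq_sub_of_hasDerivAt
    (fun s _ => hd s) ((by fun_prop : Continuous _).intervalIntegrable (0 : ℝ) 1)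
  rw [intervalIntegral.integral_sub ((by fun_prop : Continuous _).intervalIntegrable (0 : ℝ) 1)
    ((by fun_prop : Continuous _).intervalIntegrable (0 : ℝ) 1),
    intervalIntegral.integral_const_mul, intervalIntegral.integral_const_mul] at this
  have h2 : Complex.I * θ * expTaylorKernel (N + 1) θ - (N + 1) * expTaylorKernel N θ = -1 := by
    simpa [expTaylorKernel, unitFourier] using this
  linear_combination h2

/-- Taylor's formula with integral remainder for `e^{iθ}`. -/
theorem exp_eq_sum_add_expTaylorKernel (N : ℕ) (θ : ℝ) :
    Complex.exp (Complex.I * θ) = ∑ n ∈ Finset.range (N + 1),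
        ((n.factorial : ℂ))⁻¹ * (Complex.I * θ) ^ n
      + ((N.factorial : ℂ))⁻¹ * (Complex.I * θ) ^ (N + 1) * expTaylorKernel N θ := by
  induction N with
  | zero =>
    have := expTaylorKernel_zero θ
    simp
    linear_combination -this
  | succ N ih =>
    rw [ih, Finset.sum_range_succ _ (N + 1)]
    have := expTaylorKernel_succ N θ
    have hN : ((N + 1 : ℕ).factorial : ℂ) = (N + 1) * N.factorial := by
      rw [Nat.factorial_succ]; push_cast; ring
    have h0 : (N.factorial : ℂ) ≠ 0 := by exact_mod_cast N.factorial_ne_zero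
    have h1 : (N : ℂ) + 1 ≠ 0 := by exact_mod_cast N.succ_ne_zero
    have h2 : ((N.factorial : ℂ))⁻¹ = ((N + 1 : ℕ).factorial : ℂ)⁻¹ * (N + 1) := by
      rw [hN]; field_simp
    rw [h2]
    linear_combination -((N + 1 : ℕ).factorial : ℂ)⁻¹ * (Complex.I * θ) ^ (N + 1) * this

/-! ### The symplectic Fourier transform and its inversion -/

namespace WeylCalculus

variable {d : ℕ}

/-- The symplectic form as a continuous bilinear map. -/
def symplL (d : ℕ) : Phase d →L[ℝ] Phase d →L[ℝ] ℝ :=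
  (innerSL ℝ).bilinearComp (ContinuousLinearMap.snd ℝ (Config d) (Config d))
      (ContinuousLinearMap.fst ℝ (Config d) (Config d))
    - (innerSL ℝ).bilinearComp (ContinuousLinearMap.fst ℝ (Config d) (Config d))
      (ContinuousLinearMap.snd ℝ (Config d) (Config d))

@[simp]
theorem symplL_apply (X Y : Phase d) : symplL d X Y = sympl X Y := by
  simp [symplL, sympl]

theorem symplL_injective : Function.Injective (symplL d) := by
  rw [injective_iff_map_eq_zero]
  intro X hX
  have h1 : sympl X (X.2, 0) = 0 := by rw [← symplL_apply, hX]; rfl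
  have h2 : sympl X (0, X.1) = 0 := by rw [← symplL_apply, hX]; rfl
  simp only [sympl, inner_zero_right, sub_zero, zero_sub, neg_eq_zero, inner_self_eq_zero]
    at h1 h2
  exact Prod.ext h2 h1

@[fun_prop]
theorem continuous_sympl {α : Type*} [TopologicalSpace α] {u v : α → Phase d}
    (hu : Continuous u) (hv : Continuous v) : Continuous fun a => sympl (u a) (v a) := by
  unfold sympl
  fun_prop

theorem sympl_add_right (X Y Z : Phase d) : sympl X (Y + Z) = sympl X Y + sympl X Z := by
  simp [← symplL_apply]

instance : (volume : Measure (Phase d)).IsAddHaarMeasure :=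
  inferInstanceAs ((volume : Measure (Config d)).prod (volume : Measure (Config d))).IsAddHaarMeasure

theorem exists_symplFourierCLM (d : ℕ) : ∃ T : 𝓢(Phase d, ℂ) →L[ℂ] 𝓢(Phase d, ℂ),
    ∀ f X, T f X = symplFourier f X := by
  obtain ⟨T, hT⟩ := SchwartzMap.exists_oscillatoryCLM (volume : Measure (Phase d)) (symplL d)
    symplL_injective
  exact ⟨((2 * (Real.pi : ℂ)) ^ d)⁻¹ • T, fun f X => by simp [hT, symplFourier]⟩

/-- The symplectic Fourier transform on Schwartz functions. -/
def symplFourierCLM (d : ℕ) : 𝓢(Phase d, ℂ) →L[ℂ] 𝓢(Phase d, ℂ) :=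
  (exists_symplFourierCLM d).choose

theorem symplFourierCLM_apply (f : 𝓢(Phase d, ℂ)) (X : Phase d) :
    symplFourierCLM d f X = symplFourier f X :=
  (exists_symplFourierCLM d).choose_spec f X

theorem coe_symplFourierCLM (f : 𝓢(Phase d, ℂ)) : ⇑(symplFourierCLM d f) = symplFourier f :=
  funext (symplFourierCLM_apply f)

/-- The Euclidean model of phase space. -/
abbrev EuclPhase (d : ℕ) : Type := WithLp 2 (Config d × Config d)

theorem integral_ofLp (f : Phase d → ℂ) :
    ∫ v : EuclPhase d, f (WithLp.ofLp v) = ∫ X, f X := by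
  have h := WithLp.volume_preserving_ofLp (Config d) (Config d)
  exact h.integral_comp (MeasurableEquiv.toLp 2 (Config d × Config d)).symm.measurableEmbedding f

/-- The rotation of phase space by which the symplectic form differs from the inner product. -/
def rotate (Y : Phase d) : EuclPhase d := WithLp.toLp 2 (-Y.2, Y.1)

theorem measurePreserving_rotate : MeasurePreserving (rotate (d := d)) := by
  have h1 : MeasurePreserving (fun Y : Phase d => (-Y.2, Y.1)) :=
    ((Measure.measurePreserving_neg (volume : Measure (Config d))).prod
      (MeasurePreserving.id (volume : Measure (Config d)))).comp Measure.measurePreserving_swap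
  exact (WithLp.volume_preserving_toLp (Config d) (Config d)).comp h1

theorem measurableEmbedding_rotate : MeasurableEmbedding (rotate (d := d)) := by
  let e : Phase d ≃ₜ Phase d :=
    { toFun := fun Y => (-Y.2, Y.1)
      invFun := fun Y => (Y.2, -Y.1)
      left_inv := fun Y => by simp
      right_inv := fun Y => by simp }
  exact (MeasurableEquiv.toLp 2 (Config d × Config d)).measurableEmbedding.comp
    e.measurableEmbedding

/-- The rotation satisfies ⟨Y, rotate X⟩ = -σ(X, Y), and the factor (2π)⁻¹ adjusts the normalization
of the exponent. -/
theorem symplFourier_eq_fourier (f : Phase d → ℂ) (X : Phase d) :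
    symplFourier f X = ((2 * (Real.pi : ℂ)) ^ d)⁻¹ *
      𝓕 (fun v : EuclPhase d => f (WithLp.ofLp v)) ((2 * Real.pi)⁻¹ • rotate X) := by
  rw [symplFourier, Real.fourier_eq', ← integral_ofLp]
  congr 2
  ext v
  simp only [smul_eq_mul]
  congr 2
  rw [inner_smul_right, WithLp.prod_inner_apply]
  simp only [rotate, sympl, inner_neg_right, real_inner_comm]
  push_cast
  field_simp
  ring

theorem finrank_euclPhase : Module.finrank ℝ (EuclPhase d) = 2 * d := by
  rw [(WithLp.linearEquiv 2 ℝ (Config d × Config d)).finrank_eq, Module.finrank_prod,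
    finrank_euclideanSpace_fin]
  ring

/-- Antisymmetry of σ supplies the opposite sign needed for Fourier inversion, so the transform is
its own inverse. The hypotheses are weaker than Schwartz because the result is also applied to the
twisted convolution, of which only continuity and integrability are known beforehand. -/
theorem symplFourier_symplFourier {f : Phase d → ℂ} (hc : Continuous f) (hf : Integrable f)
    (hF : Integrable (symplFourier f)) : symplFourier (symplFourier f) = f := by
  ext X
  have hpi : (2 * Real.pi)⁻¹ ≠ 0 := by positivity
  set f' : EuclPhase d → ℂ := fun v => f (WithLp.ofLp v) with hf'
  have hc' : Continuous f' := by fun_prop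
  have hfi : Integrable f' :=
    ((WithLp.volume_preserving_ofLp (Config d) (Config d)).integrable_comp_emb
      (MeasurableEquiv.toLp 2 (Config d × Config d)).symm.measurableEmbedding).2 hf
  have hFi : Integrable (𝓕 f') := by
    have h1 : Integrable (fun Y => 𝓕 f' ((2 * Real.pi)⁻¹ • rotate Y)) := by
      have h2 := hF.const_mul ((2 * (Real.pi : ℂ)) ^ d)
      refine h2.congr (.of_forall fun Y => ?_)
      simp only [symplFourier_eq_fourier]
      field_simp
      rfl
    have h3 : Integrable (fun v => 𝓕 f' ((2 * Real.pi)⁻¹ • v)) :=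
      (measurePreserving_rotate.integrable_comp_emb measurableEmbedding_rotate
        (g := fun v => 𝓕 f' ((2 * Real.pi)⁻¹ • v))).1 h1
    exact (integrable_comp_smul_iff volume (𝓕 f') hpi).1 h3
  have hinv := congrFun (hc'.fourierInv_fourier_eq hfi hFi) (WithLp.toLp 2 X)
  rw [Real.fourierInv_eq'] at hinv
  have hX : f' (WithLp.toLp 2 X) = f X := rfl
  rw [hX] at hinv
  rw [← hinv, symplFourier]
  let G : EuclPhase d → ℂ := fun w =>
    Complex.exp (↑(2 * Real.pi * inner ℝ w (WithLp.toLp 2 X)) * Complex.I) • 𝓕 f' w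
  have h4 (Y : Phase d) : Complex.exp (Complex.I * (sympl X Y : ℂ)) * symplFourier f Y
      = ((2 * (Real.pi : ℂ)) ^ d)⁻¹ * G ((2 * Real.pi)⁻¹ • rotate Y) := by
    rw [symplFourier_eq_fourier]
    have h5 : Complex.I * (sympl X Y : ℂ) =
        ↑(2 * Real.pi * inner ℝ ((2 * Real.pi)⁻¹ • rotate Y) (WithLp.toLp 2 X)) * Complex.I := by
      rw [inner_smul_left, WithLp.prod_inner_apply]
      simp only [rotate, sympl, inner_neg_left, real_inner_comm, conj_trivial]
      push_cast
      field_simp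
      ring
    rw [h5]
    simp only [G, smul_eq_mul]
    ring
  simp_rw [h4]
  rw [integral_const_mul,
    measurePreserving_rotate.integral_comp measurableEmbedding_rotate
      (fun v => G ((2 * Real.pi)⁻¹ • v)),
    Measure.integral_comp_smul, finrank_euclPhase]
  -- The Jacobian of the scaling by (2π)⁻¹ in dimension 2d, which cancels the two prefactors
  -- (2π)^{-d}.
  have h6 : |((2 * Real.pi)⁻¹ ^ (2 * d))⁻¹| = (2 * Real.pi) ^ (2 * d) := by
    rw [abs_of_pos (by positivity), inv_pow, inv_inv]
  rw [h6, Complex.real_smul]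
  push_cast
  have : (2 * (Real.pi : ℂ)) ≠ 0 := by simp [Real.pi_ne_zero]
  field_simp
  rw [pow_mul']
  simp [G]

theorem symplFourierCLM_symplFourierCLM (f : 𝓢(Phase d, ℂ)) :
    symplFourierCLM d (symplFourierCLM d f) = f := by
  ext X
  rw [symplFourierCLM_apply, coe_symplFourierCLM, symplFourier_symplFourier f.continuous
    f.integrable]
  rw [← coe_symplFourierCLM]
  exact (symplFourierCLM d f).integrable

/-! ### The product symbol -/

instance : (volume : Measure (Phase d × Phase d)).IsAddHaarMeasure :=
  Measure.prod.instIsAddHaarMeasure (volume : Measure (Phase d)) (volume : Measure (Phase d))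

/-- The symplectic form between the two components of a pair. -/
def pairSympl (q : Phase d × Phase d) : ℝ := sympl q.1 q.2

theorem hasTemperateGrowth_pairSympl :
    (pairSympl (d := d)).HasTemperateGrowth := by
  have h : pairSympl (d := d) = fun q => symplL d (ContinuousLinearMap.fst ℝ _ _ q)
      (ContinuousLinearMap.snd ℝ _ _ q) := by
    ext q; simp [pairSympl]
  rw [h]
  exact (symplL d).bilinear_hasTemperateGrowth (𝕜 := ℝ)
    (ContinuousLinearMap.hasTemperateGrowth _) (ContinuousLinearMap.hasTemperateGrowth _)

theorem hasTemperateGrowth_pairSympl_pow (n : ℕ) :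
    (fun q : Phase d × Phase d => ((pairSympl q : ℝ) : ℂ) ^ n).HasTemperateGrowth :=
  (Function.HasTemperateGrowth.comp Function.Complex.hasTemperateGrowth_ofReal
    hasTemperateGrowth_pairSympl).pow n

/-- Growth is controlled jointly in ε and (Y, Z); this is what allows ε to be treated as a variable.
-/
theorem hasTemperateGrowth_remainderFactor (N : ℕ) :
    (fun p : ℝ × (Phase d × Phase d) => ((pairSympl p.2 : ℝ) : ℂ) ^ (N + 1) *
      expTaylorKernel N (p.1 / 2 * pairSympl p.2)).HasTemperateGrowth := by
  have hs : (fun p : ℝ × (Phase d × Phase d) => pairSympl p.2).HasTemperateGrowth :=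
    hasTemperateGrowth_pairSympl.comp (ContinuousLinearMap.snd ℝ ℝ (Phase d × Phase d)).hasTemperateGrowth
  have ht : (fun p : ℝ × (Phase d × Phase d) => p.1 / 2).HasTemperateGrowth := by
    have := ((1 / 2 : ℝ) • ContinuousLinearMap.fst ℝ ℝ (Phase d × Phase d)).hasTemperateGrowth
    convert this using 2
    simp; ring
  exact ((Function.HasTemperateGrowth.comp Function.Complex.hasTemperateGrowth_ofReal hs).pow (N + 1)).mul
    ((hasTemperateGrowth_expTaylorKernel N).comp (ht.mul hs))

theorem exists_cutoff : ∃ χ : 𝓢(ℝ, ℂ), ∀ t ∈ Set.Ioo (0 : ℝ) 1, χ t = 1 := by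
  let b : ContDiffBump (0 : ℝ) := ⟨1, 2, one_pos, one_lt_two⟩
  have hs : HasCompactSupport (fun t => (b t : ℂ)) :=
    b.hasCompactSupport.comp_left (g := fun x : ℝ => (x : ℂ)) Complex.ofReal_zero
  refine ⟨hs.toSchwartzMap (Complex.ofRealCLM.contDiff.comp b.contDiff), fun t ht => ?_⟩
  have : b t = 1 := b.one_of_mem_closedBall (by
    rw [Metric.mem_closedBall, Real.dist_0_eq_abs, abs_of_pos ht.1]
    exact ht.2.le)
  exact (congrArg Complex.ofReal this).trans Complex.ofReal_one

/-- A smooth cutoff function which is `1` on the unit interval. -/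
def cutoff : 𝓢(ℝ, ℂ) := exists_cutoff.choose

theorem cutoff_apply {t : ℝ} (ht : t ∈ Set.Ioo (0 : ℝ) 1) : cutoff t = 1 :=
  exists_cutoff.choose_spec t ht

/-- The form (X, (Y, Z)) ↦ σ(X, Y + Z) degenerates in (Y, Z) but not in X, and only the latter is
needed for Schwartz decay in X. -/
theorem exists_diagonalCLM (d : ℕ) : ∃ T : 𝓢(Phase d × Phase d, ℂ) →L[ℂ] 𝓢(Phase d, ℂ),
    ∀ m X, T m X = ((2 * (Real.pi : ℂ)) ^ (2 * d))⁻¹ *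
      ∫ q : Phase d × Phase d, Complex.exp (Complex.I * (sympl X (q.1 + q.2) : ℂ)) * m q := by
  let B : Phase d →L[ℝ] Phase d × Phase d →L[ℝ] ℝ :=
    (symplL d).bilinearComp (ContinuousLinearMap.id ℝ (Phase d))
      (ContinuousLinearMap.fst ℝ _ _ + ContinuousLinearMap.snd ℝ _ _)
  have hB (X : Phase d) (q : Phase d × Phase d) : B X q = sympl X (q.1 + q.2) := by
    simp [B, sympl_add_right]
  have hinj : Function.Injective B := by
    intro X X' h
    apply symplL_injective
    refine ContinuousLinearMap.ext fun Y => ?_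
    have := DFunLike.congr_fun h (Y, 0)
    simpa [hB] using this
  obtain ⟨T, hT⟩ := SchwartzMap.exists_oscillatoryCLM
    (volume : Measure (Phase d × Phase d)) B hinj
  exact ⟨((2 * (Real.pi : ℂ)) ^ (2 * d))⁻¹ • T, fun f X => by simp [hT, hB]⟩

/-- The symplectic Fourier transform of a Schwartz function of two phase space variables, restricted
to the diagonal. -/
def diagonalCLM (d : ℕ) : 𝓢(Phase d × Phase d, ℂ) →L[ℂ] 𝓢(Phase d, ℂ) :=
  (exists_diagonalCLM d).choose

theorem diagonalCLM_apply (m : 𝓢(Phase d × Phase d, ℂ)) (X : Phase d) :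
    diagonalCLM d m X = ((2 * (Real.pi : ℂ)) ^ (2 * d))⁻¹ *
      ∫ q : Phase d × Phase d, Complex.exp (Complex.I * (sympl X (q.1 + q.2) : ℂ)) * m q :=
  (exists_diagonalCLM d).choose_spec m X

/-- The tensor product of the symplectic Fourier transforms. -/
def pairSymbol (f g : 𝓢(Phase d, ℂ)) : 𝓢(Phase d × Phase d, ℂ) :=
  (symplFourierCLM d f).tensor (symplFourierCLM d g)

theorem pairSymbol_apply (f g : 𝓢(Phase d, ℂ)) (q : Phase d × Phase d) :
    pairSymbol f g q = symplFourier f q.1 * symplFourier g q.2 := by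
  simp [pairSymbol, symplFourierCLM_apply]

/-- The `n`-th term of the expansion of the Weyl product as a Schwartz function. -/
def termSchwartz (n : ℕ) (f g : 𝓢(Phase d, ℂ)) : 𝓢(Phase d, ℂ) :=
  (((n.factorial : ℂ))⁻¹ * (Complex.I / 2) ^ n) • diagonalCLM d
    (SchwartzMap.smulLeftCLM ℂ (fun q => ((pairSympl q : ℝ) : ℂ) ^ n) (pairSymbol f g))

/-- The parametrized remainder symbol, cut off in the parameter. -/
def remainderSymbol (N : ℕ) (f g : 𝓢(Phase d, ℂ)) : 𝓢(ℝ × (Phase d × Phase d), ℂ) :=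
  SchwartzMap.smulLeftCLM ℂ (fun p : ℝ × (Phase d × Phase d) => ((pairSympl p.2 : ℝ) : ℂ) ^ (N + 1) *
      expTaylorKernel N (p.1 / 2 * pairSympl p.2)) (cutoff.tensor (pairSymbol f g))

theorem remainderSymbol_apply (N : ℕ) (f g : 𝓢(Phase d, ℂ)) {ε : ℝ} (hε : ε ∈ Set.Ioo (0 : ℝ) 1)
    (q : Phase d × Phase d) :
    remainderSymbol N f g (ε, q) = ((pairSympl q : ℝ) : ℂ) ^ (N + 1) *
      expTaylorKernel N (ε / 2 * pairSympl q) * pairSymbol f g q := by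
  rw [remainderSymbol, SchwartzMap.smulLeftCLM_apply_apply (hasTemperateGrowth_remainderFactor N)]
  simp [cutoff_apply hε]

/-- The remainder of the expansion of the Weyl product as a Schwartz function. -/
def remainderSchwartz (N : ℕ) (ε : ℝ) (f g : 𝓢(Phase d, ℂ)) : 𝓢(Phase d, ℂ) :=
  (((N.factorial : ℂ))⁻¹ * (Complex.I / 2) ^ (N + 1)) • diagonalCLM d
    (SchwartzMap.slice ε (remainderSymbol N f g))

/-- Slices have seminorms at most those of the full symbol, so they form a bounded set, and its
image under a continuous linear map is bounded. -/
theorem exists_seminorm_remainderSchwartz_le (N : ℕ) (f g : 𝓢(Phase d, ℂ)) (a b : ℕ) :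
    ∃ C : ℝ, ∀ ε, SchwartzMap.seminorm ℝ a b (remainderSchwartz N ε f g) ≤ C := by
  let S : 𝓢(Phase d × Phase d, ℂ) →L[ℝ] 𝓢(Phase d, ℂ) :=
    ((((N.factorial : ℂ))⁻¹ * (Complex.I / 2) ^ (N + 1)) • diagonalCLM d).restrictScalars ℝ
  have hbdd : Bornology.IsVonNBounded ℝ
      (Set.range fun ε : ℝ => SchwartzMap.slice ε (remainderSymbol N f g)) := by
    rw [(schwartz_withSeminorms ℝ (Phase d × Phase d) ℂ).isVonNBounded_iff_seminorm_bounded]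
    rintro ⟨k, n⟩
    refine ⟨SchwartzMap.seminorm ℝ k n (remainderSymbol N f g) + 1,
      add_pos_of_nonneg_of_pos (apply_nonneg _ _) one_pos, ?_⟩
    rintro _ ⟨ε, rfl⟩
    exact (SchwartzMap.seminorm_slice_le ε _ k n).trans_lt (lt_add_one _)
  have himg := hbdd.image S
  rw [(schwartz_withSeminorms ℝ (Phase d) ℂ).isVonNBounded_iff_seminorm_bounded] at himg
  obtain ⟨C, -, hC⟩ := himg (a, b)
  exact ⟨C, fun ε => (hC _ ⟨_, ⟨ε, rfl⟩, rfl⟩).le⟩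

theorem integrable_exp_mul {E : Type*} [MeasurableSpace E] [TopologicalSpace E] [BorelSpace E]
    {μ : Measure E} {m : E → ℂ} (hm : Integrable m μ) {θ : E → ℝ} (hθ : Continuous θ) :
    Integrable (fun q => Complex.exp (Complex.I * (θ q : ℂ)) * m q) μ := by
  refine hm.bdd_mul (c := 1) (by fun_prop : Continuous _).aestronglyMeasurable ?_
  refine .of_forall fun q => ?_
  rw [mul_comm, Complex.norm_exp_ofReal_mul_I]

theorem remainderSchwartz_apply (N : ℕ) {ε : ℝ} (hε : ε ∈ Set.Ioo (0 : ℝ) 1)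
    (f g : 𝓢(Phase d, ℂ)) (X : Phase d) :
    remainderSchwartz N ε f g X = weylRemainder N ε f g X := by
  have hint : Integrable (fun q : Phase d × Phase d =>
      Complex.exp (Complex.I * (sympl X (q.1 + q.2) : ℂ)) *
        SchwartzMap.slice ε (remainderSymbol N f g) q)
      ((volume : Measure (Phase d)).prod volume) :=
    integrable_exp_mul (SchwartzMap.integrable (μ := (volume : Measure (Phase d × Phase d))) _)
      (by fun_prop)
  have h1 : remainderSchwartz N ε f g X = (((N.factorial : ℂ))⁻¹ * (Complex.I / 2) ^ (N + 1)) *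
      diagonalCLM d (SchwartzMap.slice ε (remainderSymbol N f g)) X := rfl
  rw [h1, diagonalCLM_apply, Measure.volume_eq_prod, integral_prod _ hint, weylRemainder,
    mul_left_comm, ← integral_const_mul]
  congr 2
  ext Y
  rw [← integral_const_mul]
  congr 1
  ext Z
  rw [SchwartzMap.slice_apply, remainderSymbol_apply N f g hε, pairSymbol_apply]
  simp only [expTaylorKernel, unitFourier, pairSympl]
  simp_rw [mul_assoc (_ : ℝ) (ε / 2)]
  ring

/-- The Weyl product of two Schwartz functions. -/
def weylProduct (ε : ℝ) (f g : 𝓢(Phase d, ℂ)) : 𝓢(Phase d, ℂ) :=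
  termSchwartz 0 f g + (ε : ℂ) • remainderSchwartz 0 ε f g

/-- The values of m do not involve N, so the expansions of all orders represent the same function.
Hence `weylProduct` may be defined by the one with N = 0. -/
theorem exists_expansion_symbol (N : ℕ) {ε : ℝ} (hε : ε ∈ Set.Ioo (0 : ℝ) 1)
    (f g : 𝓢(Phase d, ℂ)) : ∃ m : 𝓢(Phase d × Phase d, ℂ),
    (∀ q, m q = Complex.exp (Complex.I * ((ε / 2 * pairSympl q : ℝ) : ℂ)) * pairSymbol f g q) ∧
    (∑ n ∈ Finset.range (N + 1), (ε : ℂ) ^ n • termSchwartz n f g)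
      + (ε : ℂ) ^ (N + 1) • remainderSchwartz N ε f g = diagonalCLM d m := by
  let c (n : ℕ) : ℂ := ((n.factorial : ℂ))⁻¹ * (Complex.I / 2) ^ n
  refine ⟨∑ n ∈ Finset.range (N + 1), (ε : ℂ) ^ n • c n •
      SchwartzMap.smulLeftCLM ℂ (fun q => ((pairSympl q : ℝ) : ℂ) ^ n) (pairSymbol f g)
    + (ε : ℂ) ^ (N + 1) • (((N.factorial : ℂ))⁻¹ * (Complex.I / 2) ^ (N + 1)) •
      SchwartzMap.slice ε (remainderSymbol N f g), fun q => ?_, ?_⟩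
  · rw [exp_eq_sum_add_expTaylorKernel N, add_mul, Finset.sum_mul]
    simp only [add_apply, sum_apply, smul_apply,
      SchwartzMap.slice_apply, remainderSymbol_apply N f g hε,
      SchwartzMap.smulLeftCLM_apply_apply (hasTemperateGrowth_pairSympl_pow _), smul_eq_mul, c]
    push_cast
    congr 1
    · refine Finset.sum_congr rfl fun n _ => ?_
      rw [mul_pow, mul_pow, div_pow, div_pow]
      ring
    · rw [mul_pow, mul_pow, div_pow, div_pow]
      ring
  · simp only [map_add, map_sum, map_smul, termSchwartz, remainderSchwartz, c]

theorem diagonalCLM_congr {m m' : 𝓢(Phase d × Phase d, ℂ)} (h : ∀ q, m q = m' q) :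
    diagonalCLM d m = diagonalCLM d m' := by
  rw [SchwartzMap.ext h]

theorem weylProduct_eq_sum_add (N : ℕ) {ε : ℝ} (hε : ε ∈ Set.Ioo (0 : ℝ) 1)
    (f g : 𝓢(Phase d, ℂ)) :
    weylProduct ε f g = (∑ n ∈ Finset.range (N + 1), (ε : ℂ) ^ n • termSchwartz n f g)
      + (ε : ℂ) ^ (N + 1) • remainderSchwartz N ε f g := by
  obtain ⟨m, hm, h⟩ := exists_expansion_symbol N hε f g
  obtain ⟨m', hm', h'⟩ := exists_expansion_symbol 0 hε f g
  rw [h, diagonalCLM_congr fun q => (hm q).trans (hm' q).symm, ← h']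
  simp [weylProduct]

theorem weylProduct_apply {ε : ℝ} (hε : ε ∈ Set.Ioo (0 : ℝ) 1) (f g : 𝓢(Phase d, ℂ))
    (X : Phase d) :
    weylProduct ε f g X = ((2 * (Real.pi : ℂ)) ^ (2 * d))⁻¹ *
      ∫ q : Phase d × Phase d, Complex.exp (Complex.I * (sympl X (q.1 + q.2) : ℂ)) *
        (Complex.exp (Complex.I * ((ε / 2 * pairSympl q : ℝ) : ℂ)) *
          (symplFourier f q.1 * symplFourier g q.2)) := by
  obtain ⟨m, hm, h⟩ := exists_expansion_symbol 0 hε f g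
  rw [weylProduct_eq_sum_add 0 hε, h, diagonalCLM_apply]
  simp_rw [hm, pairSymbol_apply]

/-! ### Twisted convolution and composition of Weyl operators -/

theorem integrable_convolution_integrand {Φ : Phase d × Phase d → ℂ} (hΦ : Integrable Φ) :
    Integrable (fun p : Phase d × Phase d => Φ (p.2, p.1 - p.2)) :=
  ((measurePreserving_prod_sub_swap (volume : Measure (Phase d))
    (volume : Measure (Phase d))).integrable_comp hΦ.aestronglyMeasurable).2 hΦ

/-- Fubini and the substitution X = Y + Z. Used with w a Fourier exponential and with w = W(·)φ(x).
-/
theorem integral_convolution_mul {Φ : Phase d × Phase d → ℂ} (hΦ : Integrable Φ)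
    {w : Phase d → ℂ} (hw : Continuous w) {C : ℝ} (hC : ∀ X, ‖w X‖ ≤ C) :
    ∫ X, (∫ Y, Φ (Y, X - Y)) * w X = ∫ q : Phase d × Phase d, Φ q * w (q.1 + q.2) := by
  have h1 : Integrable (fun q : Phase d × Phase d => Φ q * w (q.1 + q.2)) :=
    hΦ.mul_bdd (c := C) (by fun_prop : Continuous _).aestronglyMeasurable
      (.of_forall fun q => hC _)
  have h2 := integrable_convolution_integrand h1
  have h4 : Integrable (fun q : Phase d × Phase d => Φ q * w (q.1 + q.2))
    ((volume : Measure (Phase d)).prod volume) := h1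
  have h5 : ∫ q : Phase d × Phase d, Φ q * w (q.1 + q.2) = ∫ Y, ∫ Z, Φ (Y, Z) * w (Y + Z) :=
    integral_prod _ h4
  rw [h5]
  have h3 (Y : Phase d) : ∫ Z, Φ (Y, Z) * w (Y + Z) = ∫ X, Φ (Y, X - Y) * w X := by
    rw [← integral_sub_right_eq_self _ Y]
    simp
  simp_rw [← integral_mul_const, h3]
  rw [integral_integral_swap]
  simp only [add_sub_cancel] at h2
  exact h2

theorem integrable_convolution {Φ : Phase d × Phase d → ℂ} (hΦ : Integrable Φ) :
    Integrable (fun X => ∫ Y, Φ (Y, X - Y)) :=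
  Integrable.integral_prod_left (f := fun p : Phase d × Phase d => Φ (p.2, p.1 - p.2))
    (integrable_convolution_integrand hΦ)

/-- Both sides translate by ε(y + z); the phases differ by (ε/2)(η·z - y·ζ) = (ε/2)σ(Y, Z). -/
theorem weylSystem_weylSystem (ε : ℝ) (Y Z : Phase d) (φ : Config d → ℂ) (x : Config d) :
    weylSystem ε Y (weylSystem ε Z φ) x =
      Complex.exp (Complex.I * ((ε / 2 * sympl Y Z : ℝ) : ℂ)) * weylSystem ε (Y + Z) φ x := by
  unfold weylSystem
  rw [← mul_assoc, ← mul_assoc, ← Complex.exp_add, ← Complex.exp_add]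
  have h1 : x + ε • Y.1 + ε • Z.1 = x + ε • (Y + Z).1 := by
    rw [Prod.fst_add, smul_add, add_assoc]
  rw [h1]
  congr 2
  simp only [sympl, Prod.fst_add, Prod.snd_add, inner_add_left, inner_add_right, inner_smul_right,
    smul_add]
  rw [real_inner_comm Z.2 Y.1]
  push_cast
  ring

theorem norm_weylSystem_le (ε : ℝ) (Y : Phase d) {φ : Config d → ℂ} {C : ℝ} (hC : ∀ x, ‖φ x‖ ≤ C)
    (x : Config d) : ‖weylSystem ε Y φ x‖ ≤ C := by
  rw [weylSystem, norm_mul, ← mul_neg, ← Complex.ofReal_neg, mul_comm Complex.I,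
    Complex.norm_exp_ofReal_mul_I, one_mul]
  exact hC _

theorem continuous_weylSystem (ε : ℝ) {φ : Config d → ℂ} (hφ : Continuous φ) (x : Config d) :
    Continuous (fun Y => weylSystem ε Y φ x) := by
  unfold weylSystem
  fun_prop

theorem weylSystem_weylOp (ε : ℝ) (g : Phase d → ℂ) (φ : Config d → ℂ) (Y : Phase d)
    (x : Config d) :
    weylSystem ε Y (weylOp ε g φ) x = ((2 * (Real.pi : ℂ)) ^ d)⁻¹ *
      ∫ Z, symplFourier g Z * weylSystem ε Y (weylSystem ε Z φ) x := by
  simp only [weylSystem, weylOp]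
  rw [mul_left_comm, ← integral_const_mul]
  congr 2
  ext Z
  ring

/-- The integrand of the twisted convolution. -/
def twistedSymbol (ε : ℝ) (f g : 𝓢(Phase d, ℂ)) (q : Phase d × Phase d) : ℂ :=
  Complex.exp (Complex.I * ((ε / 2 * pairSympl q : ℝ) : ℂ)) *
    (symplFourier f q.1 * symplFourier g q.2)

theorem integrable_twistedSymbol (ε : ℝ) (f g : 𝓢(Phase d, ℂ)) :
    Integrable (twistedSymbol ε f g) := by
  have h := (pairSymbol f g).integrable (μ := volume)
  have heq : twistedSymbol ε f g = fun q =>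
      Complex.exp (Complex.I * ((ε / 2 * pairSympl q : ℝ) : ℂ)) * pairSymbol f g q := by
    ext q; rw [twistedSymbol, pairSymbol_apply]
  rw [heq]
  refine integrable_exp_mul h ?_
  unfold pairSympl
  fun_prop

/-- The twisted convolution of the symplectic Fourier transforms. -/
def twistedConvolution (ε : ℝ) (f g : 𝓢(Phase d, ℂ)) (X : Phase d) : ℂ :=
  ((2 * (Real.pi : ℂ)) ^ d)⁻¹ * ∫ Y, twistedSymbol ε f g (Y, X - Y)

theorem continuous_twistedConvolution (ε : ℝ) (f g : 𝓢(Phase d, ℂ)) :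
    Continuous (twistedConvolution ε f g) := by
  have hf := (symplFourierCLM d f).continuous
  have hg := (symplFourierCLM d g).continuous
  have hfi := (symplFourierCLM d f).integrable (μ := volume)
  have hgb := SchwartzMap.norm_le_seminorm ℝ (symplFourierCLM d g)
  rw [coe_symplFourierCLM] at hf hg hfi hgb
  refine continuous_const.mul (continuous_of_dominated
    (bound := fun Y => ‖symplFourier f Y‖ * SchwartzMap.seminorm ℝ 0 0 (symplFourierCLM d g))
    (fun X => ?_) (fun X => ?_) (hfi.norm.mul_const _) (.of_forall fun Y => ?_))
  · unfold twistedSymbol pairSympl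
    exact (by fun_prop : Continuous _).aestronglyMeasurable
  · refine .of_forall fun Y => ?_
    rw [twistedSymbol, norm_mul, mul_comm Complex.I, Complex.norm_exp_ofReal_mul_I, one_mul,
      norm_mul]
    gcongr
    exact hgb _
  · unfold twistedSymbol pairSympl
    fun_prop

theorem integrable_twistedConvolution (ε : ℝ) (f g : 𝓢(Phase d, ℂ)) :
    Integrable (twistedConvolution ε f g) :=
  (integrable_convolution (integrable_twistedSymbol ε f g)).const_mul _

theorem integral_twistedConvolution_mul (ε : ℝ) (f g : 𝓢(Phase d, ℂ)) {w : Phase d → ℂ}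
    (hw : Continuous w) {C : ℝ} (hC : ∀ X, ‖w X‖ ≤ C) :
    ∫ X, twistedConvolution ε f g X * w X = ((2 * (Real.pi : ℂ)) ^ d)⁻¹ *
      ∫ q : Phase d × Phase d, twistedSymbol ε f g q * w (q.1 + q.2) := by
  rw [← integral_convolution_mul (integrable_twistedSymbol ε f g) hw hC, ← integral_const_mul]
  simp only [twistedConvolution, mul_assoc]

theorem symplFourier_twistedConvolution {ε : ℝ} (hε : ε ∈ Set.Ioo (0 : ℝ) 1)
    (f g : 𝓢(Phase d, ℂ)) :
    symplFourier (twistedConvolution ε f g) = weylProduct ε f g := by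
  ext X
  have h := integral_twistedConvolution_mul ε f g
    (w := fun Y => Complex.exp (Complex.I * (sympl X Y : ℂ))) (by fun_prop) (C := 1)
    (fun Y => by rw [mul_comm, Complex.norm_exp_ofReal_mul_I])
  rw [weylProduct_apply hε, symplFourier]
  simp_rw [mul_comm (Complex.exp (Complex.I * (sympl X _ : ℂ)))]
  rw [h, ← mul_assoc, pow_mul', sq, mul_inv]
  rfl

/-- Inversion applies because the transform of the twisted convolution is already known to be a
Schwartz function, hence integrable. -/
theorem symplFourier_weylProduct {ε : ℝ} (hε : ε ∈ Set.Ioo (0 : ℝ) 1) (f g : 𝓢(Phase d, ℂ)) :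
    symplFourier (weylProduct ε f g) = twistedConvolution ε f g := by
  rw [← symplFourier_twistedConvolution hε]
  refine symplFourier_symplFourier (continuous_twistedConvolution ε f g)
    (integrable_twistedConvolution ε f g) ?_
  rw [symplFourier_twistedConvolution hε]
  exact (weylProduct ε f g).integrable

theorem isWeylProduct_weylProduct {ε : ℝ} (hε : ε ∈ Set.Ioo (0 : ℝ) 1) (f g : 𝓢(Phase d, ℂ)) :
    IsWeylProduct ε f g (weylProduct ε f g) := by
  intro φ
  ext x
  have hφ := SchwartzMap.norm_le_seminorm ℝ φ
  have hwc := continuous_weylSystem ε φ.continuous x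
  have hwb (Y : Phase d) := norm_weylSystem_le ε Y hφ x
  have hint : Integrable (fun q : Phase d × Phase d =>
      twistedSymbol ε f g q * weylSystem ε (q.1 + q.2) φ x)
      ((volume : Measure (Phase d)).prod volume) :=
    (integrable_twistedSymbol ε f g).mul_bdd
      (hwc.comp (continuous_fst.add continuous_snd)).aestronglyMeasurable
      (.of_forall fun q => hwb _)
  have hprod : ∫ q : Phase d × Phase d, twistedSymbol ε f g q * weylSystem ε (q.1 + q.2) φ x =
      ∫ Y, ∫ Z, twistedSymbol ε f g (Y, Z) * weylSystem ε (Y + Z) φ x := integral_prod _ hint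
  rw [weylOp, symplFourier_weylProduct hε, integral_twistedConvolution_mul ε f g hwc hwb,
    hprod, weylOp]
  congr 1
  rw [← integral_const_mul]
  congr 1
  ext Y
  rw [weylSystem_weylOp, mul_left_comm]
  congr 1
  rw [← integral_const_mul]
  congr 1
  ext Z
  rw [weylSystem_weylSystem, twistedSymbol, pairSympl]
  ring

/-! ### The terms of the expansion -/

/-- The direct sum of two copies of the symplectic form. -/
def pairForm (d : ℕ) : Phase d × Phase d →L[ℝ] Phase d × Phase d →L[ℝ] ℝ :=
  (symplL d).bilinearComp (ContinuousLinearMap.fst ℝ _ _) (ContinuousLinearMap.fst ℝ _ _)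
    + (symplL d).bilinearComp (ContinuousLinearMap.snd ℝ _ _) (ContinuousLinearMap.snd ℝ _ _)

theorem pairForm_apply (p q : Phase d × Phase d) :
    pairForm d p q = sympl p.1 q.1 + sympl p.2 q.2 := by
  simp [pairForm]

/-- The symplectic Fourier integral of a function of two phase space variables. -/
def pairIntegral (m : Phase d × Phase d → ℂ) (p : Phase d × Phase d) : ℂ :=
  ∫ q : Phase d × Phase d, Complex.exp (Complex.I * (pairForm d p q : ℂ)) * m q

theorem hasFDerivAt_pairIntegral (m : 𝓢(Phase d × Phase d, ℂ)) (p v : Phase d × Phase d) :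
    DifferentiableAt ℝ (pairIntegral m) p ∧ fderiv ℝ (pairIntegral m) p v =
      pairIntegral (fun q => Complex.I * (pairForm d v q : ℂ) * m q) p := by
  -- Normalized so that the Fourier character at -L(q, p) is e^{iB(p, q)}.
  let L : Phase d × Phase d →L[ℝ] Phase d × Phase d →L[ℝ] ℝ :=
    (-(2 * Real.pi)⁻¹ : ℝ) • (pairForm d).flip
  have hexp (p q : Phase d × Phase d) :
      ((Real.fourierChar (-L q p) : Circle) : ℂ) = Complex.exp (Complex.I * (pairForm d p q : ℂ)) := by
    rw [Real.fourierChar_apply]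
    congr 1
    simp only [L, smul_apply, ContinuousLinearMap.flip_apply, smul_eq_mul]
    push_cast
    have : (Real.pi : ℂ) ≠ 0 := by simp [Real.pi_ne_zero]
    field_simp
  have hF (p : Phase d × Phase d) : pairIntegral m p =
      VectorFourier.fourierIntegral Real.fourierChar volume L.toLinearMap₁₂ m p := by
    simp only [pairIntegral, VectorFourier.fourierIntegral, Circle.smul_def, smul_eq_mul]
    congr 1
    ext q
    rw [← hexp]
    rfl
  have hm1 : Integrable (fun q => ‖q‖ * ‖m q‖) (volume : Measure (Phase d × Phase d)) := by
    simpa using m.integrable_pow_mul volume 1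
  have h := VectorFourier.hasFDerivAt_fourierIntegral L (m.integrable (μ := volume)) hm1 p
  rw [← funext hF] at h
  refine ⟨h.differentiableAt, ?_⟩
  rw [h.fderiv, VectorFourier.fourierIntegral, ContinuousLinearMap.integral_apply]
  · simp only [pairIntegral]
    congr 1
    ext q
    have h1 : Real.fourierChar (-L.toLinearMap₁₂ q p) = Real.fourierChar (-L q p) := rfl
    rw [h1, Circle.smul_def, hexp, smul_apply,
      VectorFourier.fourierSMulRight_apply]
    simp only [L, smul_apply, ContinuousLinearMap.flip_apply, smul_eq_mul,
      Complex.real_smul]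
    push_cast
    have : (Real.pi : ℂ) ≠ 0 := by simp [Real.pi_ne_zero]
    field_simp
  · refine (VectorFourier.fourierIntegral_convergent_iff Real.continuous_fourierChar
      (by apply L.continuous₂) p).2 ?_
    refine (hm1.const_mul (2 * Real.pi * ‖L‖)).mono'
      (m.integrable (μ := volume)).aestronglyMeasurable.fourierSMulRight ?_
    refine .of_forall fun q => ?_
    simpa [mul_assoc] using VectorFourier.norm_fourierSMulRight_le L m q

theorem hasTemperateGrowth_pairForm (v : Phase d × Phase d) :
    (fun q => Complex.I * (pairForm d v q : ℂ)).HasTemperateGrowth :=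
  (Function.HasTemperateGrowth.const Complex.I).mul
    (Function.HasTemperateGrowth.comp Function.Complex.hasTemperateGrowth_ofReal
      (pairForm d v).hasTemperateGrowth)

/-- Multiplication of a Schwartz function by `i B(v, q)`. -/
def mulForm (v : Phase d × Phase d) (m : 𝓢(Phase d × Phase d, ℂ)) : 𝓢(Phase d × Phase d, ℂ) :=
  SchwartzMap.smulLeftCLM ℂ (fun q => Complex.I * (pairForm d v q : ℂ)) m

theorem mulForm_apply (v : Phase d × Phase d) (m : 𝓢(Phase d × Phase d, ℂ))
    (q : Phase d × Phase d) : mulForm v m q = Complex.I * (pairForm d v q : ℂ) * m q := by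
  rw [mulForm, SchwartzMap.smulLeftCLM_apply_apply (hasTemperateGrowth_pairForm v), smul_eq_mul]

theorem dirDeriv_pairIntegral (v : Phase d × Phase d) (m : 𝓢(Phase d × Phase d, ℂ)) :
    dirDeriv v (pairIntegral m) = pairIntegral (mulForm v m) := by
  ext p
  rw [dirDeriv, (hasFDerivAt_pairIntegral m p v).2]
  simp only [pairIntegral, mulForm_apply]

theorem dirDeriv_const_mul (v : Phase d × Phase d) (c : ℂ) (m : 𝓢(Phase d × Phase d, ℂ)) :
    dirDeriv v (fun p => c * pairIntegral m p) = fun p => c * dirDeriv v (pairIntegral m) p := by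
  ext p
  simp [dirDeriv, fderiv_const_mul (hasFDerivAt_pairIntegral m p v).1]

theorem integrable_pairIntegral (m : 𝓢(Phase d × Phase d, ℂ)) (p : Phase d × Phase d) :
    Integrable (fun q : Phase d × Phase d =>
      Complex.exp (Complex.I * (pairForm d p q : ℂ)) * m q) :=
  integrable_exp_mul m.integrable (pairForm d p).continuous

theorem sympl_zero_left (Y : Phase d) : sympl 0 Y = 0 := by
  simp [sympl]

theorem sympl_posDir (j : Fin d) (Y : Phase d) : sympl (posDir j) Y = -Y.2 j := by
  simp [sympl, posDir, EuclideanSpace.inner_single_left]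

theorem sympl_momDir (j : Fin d) (Y : Phase d) : sympl (momDir j) Y = Y.1 j := by
  simp [sympl, momDir, EuclideanSpace.inner_single_left]

/-- The Fourier symbol of `biDiff` is exactly σ(Y, Z): derivatives along x_j and ξ_j contribute
-iη_j and iy_j, and similarly for Z. -/
theorem pairSympl_eq_sum (q : Phase d × Phase d) :
    ((pairSympl q : ℝ) : ℂ) = ∑ j : Fin d,
      (Complex.I * (pairForm d ((posDir j, 0) : Phase d × Phase d) q : ℂ) *
          (Complex.I * (pairForm d ((0, momDir j) : Phase d × Phase d) q : ℂ))
        - Complex.I * (pairForm d ((momDir j, 0) : Phase d × Phase d) q : ℂ) *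
          (Complex.I * (pairForm d ((0, posDir j) : Phase d × Phase d) q : ℂ))) := by
  simp only [pairForm_apply, sympl_posDir, sympl_momDir, sympl_zero_left]
  simp only [pairSympl, sympl, PiLp.inner_apply, RCLike.inner_apply, conj_trivial]
  push_cast
  rw [← Finset.sum_sub_distrib]
  refine Finset.sum_congr rfl fun j _ => ?_
  linear_combination (q.1.2.ofLp j * q.2.1.ofLp j - q.1.1.ofLp j * q.2.2.ofLp j : ℂ) * Complex.I_sq

theorem biDiff_const_mul_pairIntegral (c : ℂ) (m : 𝓢(Phase d × Phase d, ℂ)) :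
    biDiff (fun p => c * pairIntegral m p) =
      fun p => c * pairIntegral (fun q => ((pairSympl q : ℝ) : ℂ) * m q) p := by
  ext p
  simp only [biDiff, dirDeriv_const_mul, dirDeriv_pairIntegral]
  simp_rw [← mul_sub]
  rw [← Finset.mul_sum]
  congr 1
  simp only [pairIntegral]
  simp_rw [← integral_sub (integrable_pairIntegral _ p) (integrable_pairIntegral _ p)]
  refine (integral_finsetSum _
    (fun j _ => (integrable_pairIntegral _ p).sub (integrable_pairIntegral _ p))).symm.trans ?_
  congr 1
  ext q
  rw [pairSympl_eq_sum, Finset.sum_mul, Finset.mul_sum]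
  refine Finset.sum_congr rfl fun j _ => ?_
  simp only [mulForm_apply, Pi.sub_apply]
  ring

theorem tensor_eq_pairIntegral (f g : 𝓢(Phase d, ℂ)) :
    (fun p : Phase d × Phase d => f p.1 * g p.2) =
      fun p => ((2 * (Real.pi : ℂ)) ^ (2 * d))⁻¹ * pairIntegral (pairSymbol f g) p := by
  ext p
  have hf : f p.1 = symplFourier (symplFourier f) p.1 := by
    rw [← coe_symplFourierCLM f, ← symplFourierCLM_apply, symplFourierCLM_symplFourierCLM]
  have hg : g p.2 = symplFourier (symplFourier g) p.2 := by
    rw [← coe_symplFourierCLM g, ← symplFourierCLM_apply, symplFourierCLM_symplFourierCLM]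
  rw [hf, hg, symplFourier, symplFourier, mul_mul_mul_comm, pow_mul', sq, mul_inv,
    ← integral_prod_mul, pairIntegral, Measure.volume_eq_prod]
  congr 2
  ext q
  rw [pairSymbol_apply, pairForm_apply, Complex.ofReal_add, mul_add, Complex.exp_add]
  ring

theorem iterate_biDiff_tensor (n : ℕ) (f g : 𝓢(Phase d, ℂ)) :
    biDiff^[n] (fun p : Phase d × Phase d => f p.1 * g p.2) =
      fun p => ((2 * (Real.pi : ℂ)) ^ (2 * d))⁻¹ * pairIntegral
        (SchwartzMap.smulLeftCLM ℂ (fun q => ((pairSympl q : ℝ) : ℂ) ^ n) (pairSymbol f g)) p := by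
  induction n with
  | zero =>
    rw [Function.iterate_zero, id, tensor_eq_pairIntegral]
    simp
  | succ n ih =>
    rw [Function.iterate_succ_apply', ih, biDiff_const_mul_pairIntegral]
    ext p
    congr 2
    ext q
    rw [SchwartzMap.smulLeftCLM_apply_apply (hasTemperateGrowth_pairSympl_pow _),
      SchwartzMap.smulLeftCLM_apply_apply (hasTemperateGrowth_pairSympl_pow _), smul_eq_mul,
      smul_eq_mul, pow_succ]
    ring

theorem termSchwartz_apply (n : ℕ) (f g : 𝓢(Phase d, ℂ)) (X : Phase d) :
    termSchwartz n f g X = weylTerm n f g X := by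
  have h1 : termSchwartz n f g X = (((n.factorial : ℂ))⁻¹ * (Complex.I / 2) ^ n) *
    diagonalCLM d (SchwartzMap.smulLeftCLM ℂ (fun q => ((pairSympl q : ℝ) : ℂ) ^ n)
      (pairSymbol f g)) X := rfl
  rw [h1, weylTerm, iterate_biDiff_tensor, diagonalCLM_apply]
  simp only [pairIntegral, pairForm_apply, sympl_add_right]

theorem biDiff_tensor (f g : 𝓢(Phase d, ℂ)) (X : Phase d) :
    biDiff (fun p : Phase d × Phase d => f p.1 * g p.2) (X, X) = -poisson f g X := by
  have h1 (u : Phase d) : dirDeriv ((0, u) : Phase d × Phase d)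
      (fun p : Phase d × Phase d => f p.1 * g p.2) = fun p => f p.1 * dirDeriv u g p.2 := by
    ext p
    have hf : HasFDerivAt (fun p : Phase d × Phase d => f p.1) _ p :=
      (f.hasFDerivAt p.1).comp p hasFDerivAt_fst
    have hg : HasFDerivAt (fun p : Phase d × Phase d => g p.2) _ p :=
      (g.hasFDerivAt p.2).comp p hasFDerivAt_snd
    rw [dirDeriv, (hf.fun_mul hg).fderiv]
    simp [dirDeriv]
  have h2 (u v : Phase d) (p : Phase d × Phase d) : dirDeriv ((v, 0) : Phase d × Phase d)
      (fun p : Phase d × Phase d => f p.1 * dirDeriv u g p.2) p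
        = dirDeriv v f p.1 * dirDeriv u g p.2 := by
    have hf : HasFDerivAt (fun p : Phase d × Phase d => f p.1) _ p :=
      (f.hasFDerivAt p.1).comp p hasFDerivAt_fst
    have hg : HasFDerivAt (fun p : Phase d × Phase d => dirDeriv u g p.2) _ p :=
      -- A directional derivative of g is again Schwartz, hence differentiable.
      ((LineDeriv.lineDerivOp u g : 𝓢(Phase d, ℂ)).hasFDerivAt p.2).comp p hasFDerivAt_snd
    rw [dirDeriv, (hf.fun_mul hg).fderiv]
    simp [dirDeriv, mul_comm]
  simp only [biDiff, poisson, h1, h2, ← Finset.sum_neg_distrib, neg_sub]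

/-! ### Injectivity of the Weyl quantization -/

/-- A partial Fourier transform of `D` in the momentum variable. -/
def momentumFourier (ε : ℝ) (D : Phase d → ℂ) (x y : Config d) : ℂ :=
  ∫ η : Config d, Complex.exp (-(Complex.I * (inner ℝ η (x + (ε / 2) • y) : ℝ))) * D (y, η)

/-- A majorant in η uniform in y, for dominated convergence. -/
theorem exists_decay_snd (D : 𝓢(Phase d, ℂ)) (k : ℕ) :
    ∃ C : ℝ, ∀ y η : Config d, ‖D (y, η)‖ ≤ C * (1 + ‖η‖) ^ (-(k : ℝ)) := by
  refine ⟨2 ^ k * ((Finset.Iic (k, 0)).sup fun m : ℕ × ℕ => SchwartzMap.seminorm ℝ m.1 m.2) D,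
    fun y η => ?_⟩
  have h := SchwartzMap.one_add_le_sup_seminorm_apply (𝕜 := ℝ) (m := (k, 0)) le_rfl le_rfl D (y, η)
  rw [norm_iteratedFDeriv_zero] at h
  have hp : (0 : ℝ) < (1 + ‖η‖) ^ k := by positivity
  rw [Real.rpow_neg (by positivity), Real.rpow_natCast, ← div_eq_mul_inv, le_div_iff₀ hp]
  refine le_trans ?_ h
  rw [mul_comm]
  gcongr
  exact norm_snd_le (y, η)

theorem continuous_momentumFourier (ε : ℝ) (D : 𝓢(Phase d, ℂ)) (x : Config d) :
    Continuous (momentumFourier ε D x) := by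
  -- An exponent above d makes the majorant integrable on ℝ^d.
  obtain ⟨C, hC⟩ := exists_decay_snd D (d + 1)
  have hD := D.continuous
  refine continuous_of_dominated
    (bound := fun η => C * (1 + ‖η‖) ^ (-((d + 1 : ℕ) : ℝ)))
    (fun y => (by fun_prop : Continuous _).aestronglyMeasurable) (fun y => ?_) ?_
    (.of_forall fun η => by fun_prop)
  · refine .of_forall fun η => ?_
    rw [norm_mul, ← mul_neg, ← Complex.ofReal_neg, mul_comm Complex.I,
      Complex.norm_exp_ofReal_mul_I, one_mul]
    exact hC y η
  · refine (integrable_one_add_norm ?_).const_mul C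
    rw [finrank_euclideanSpace_fin]
    push_cast
    linarith

theorem integral_mul_weylSystem (ε : ℝ) (D : 𝓢(Phase d, ℂ)) (φ : 𝓢(Config d, ℂ)) (x : Config d) :
    ∫ X, D X * weylSystem ε X φ x = ∫ y, φ (x + ε • y) * momentumFourier ε D x y := by
  have hint : Integrable (fun X => D X * weylSystem ε X φ x)
      ((volume : Measure (Config d)).prod volume) :=
    (D.integrable (μ := volume)).mul_bdd
      (continuous_weylSystem ε φ.continuous x).aestronglyMeasurable
      (.of_forall fun Y => norm_weylSystem_le ε Y (SchwartzMap.norm_le_seminorm ℝ φ) x)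
  have hprod : ∫ X, D X * weylSystem ε X φ x =
      ∫ y, ∫ η, D (y, η) * weylSystem ε (y, η) φ x := integral_prod _ hint
  rw [hprod]
  congr 1
  ext y
  rw [momentumFourier, ← integral_const_mul]
  congr 1
  ext η
  simp only [weylSystem]
  ring

theorem exists_schwartz_comp_affine {ε : ℝ} (hε : ε ≠ 0) (x : Config d) {ψ : Config d → ℝ}
    (hψ : ContDiff ℝ ∞ ψ) (hs : HasCompactSupport ψ) :
    ∃ φ : 𝓢(Config d, ℂ), ∀ y, φ (x + ε • y) = ψ y := by
  let e : Config d ≃ₜ Config d :=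
    (Homeomorph.subRight x).trans (Homeomorph.smulOfNeZero ε⁻¹ (inv_ne_zero hε))
  have he (z : Config d) : e z = ε⁻¹ • (z - x) := rfl
  have h1 : HasCompactSupport (fun z => (ψ (e z) : ℂ)) :=
    (hs.comp_homeomorph e).comp_left (g := fun r : ℝ => (r : ℂ)) Complex.ofReal_zero
  have h2 : ContDiff ℝ ∞ (fun z => (ψ (e z) : ℂ)) := by
    simp only [he]
    exact Complex.ofRealCLM.contDiff.comp (hψ.comp (by fun_prop))
  refine ⟨h1.toSchwartzMap h2, fun y => ?_⟩
  have : e (x + ε • y) = y := by rw [he]; simp [smul_smul, hε]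
  exact congrArg (fun z => (ψ z : ℂ)) this

/-- For ε ≠ 0 the functions y ↦ φ(x + εy) include all test functions, so the partial transform
vanishes almost everywhere, and by continuity everywhere. -/
theorem momentumFourier_eq_zero {ε : ℝ} (hε : ε ≠ 0) {D : 𝓢(Phase d, ℂ)}
    (h : ∀ (φ : 𝓢(Config d, ℂ)) (x : Config d), ∫ X, D X * weylSystem ε X φ x = 0)
    (x y : Config d) : momentumFourier ε D x y = 0 := by
  have hc := continuous_momentumFourier ε D x
  have hae : ∀ᵐ y, momentumFourier ε D x y = 0 := by
    refine ae_eq_zero_of_integral_contDiff_smul_eq_zero hc.locallyIntegrable fun ψ hψ hs => ?_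
    obtain ⟨φ, hφ⟩ := exists_schwartz_comp_affine hε x hψ hs
    rw [← h φ x, integral_mul_weylSystem]
    simp [hφ]
  exact congrFun ((hc.ae_eq_iff_eq volume continuous_const).1 hae) y

theorem eq_zero_of_integral_mul_weylSystem {ε : ℝ} (hε : ε ≠ 0) {D : 𝓢(Phase d, ℂ)}
    (h : ∀ (φ : 𝓢(Config d, ℂ)) (x : Config d), ∫ X, D X * weylSystem ε X φ x = 0) : D = 0 := by
  ext ⟨y, η⟩
  let s : 𝓢(Config d, ℂ) := SchwartzMap.slice y D
  have hs : 𝓕 s = 0 := by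
    ext w
    rw [SchwartzMap.fourier_coe, Real.fourier_eq']
    -- This x makes x + (ε/2)y equal to 2πw, so the phase is that of the Fourier transform at w.
    refine Eq.trans ?_ (momentumFourier_eq_zero hε h ((2 * Real.pi) • w - (ε / 2) • y) y)
    rw [momentumFourier]
    congr 1
    ext η
    simp only [s, SchwartzMap.slice_apply, smul_eq_mul, sub_add_cancel, inner_smul_right]
    congr 2
    push_cast
    ring
  have h0 : s = 0 := by
    have hinv : 𝓕⁻ (𝓕 s) = s := FourierTransform.fourierInv_fourier_eq s
    rw [← hinv, hs]
    exact map_zero (FourierTransform.fourierInvCLM ℂ 𝓢(Config d, ℂ))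
  exact DFunLike.congr_fun h0 η

theorem IsWeylProduct.unique {ε : ℝ} (hε : ε ≠ 0) {f g h h' : 𝓢(Phase d, ℂ)}
    (hh : IsWeylProduct ε f g h) (hh' : IsWeylProduct ε f g h') : h = h' := by
  have hc : ((2 * (Real.pi : ℂ)) ^ d)⁻¹ ≠ 0 := by simp [Real.pi_ne_zero]
  have hint (k : 𝓢(Phase d, ℂ)) (φ : 𝓢(Config d, ℂ)) (x : Config d) :
      Integrable fun X => symplFourierCLM d k X * weylSystem ε X φ x :=
    ((symplFourierCLM d k).integrable (μ := volume)).mul_bdd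
      (continuous_weylSystem ε φ.continuous x).aestronglyMeasurable
      (.of_forall fun Y => norm_weylSystem_le ε Y (SchwartzMap.norm_le_seminorm ℝ φ) x)
  have hD : symplFourierCLM d h - symplFourierCLM d h' = 0 := by
    refine eq_zero_of_integral_mul_weylSystem hε fun φ x => ?_
    have h1 := congrFun ((hh φ).trans (hh' φ).symm) x
    rw [weylOp, weylOp, mul_right_inj' hc, ← coe_symplFourierCLM, ← coe_symplFourierCLM] at h1
    simp only [sub_apply, sub_mul]
    rw [integral_sub (hint h φ x) (hint h' φ x), h1, sub_self]
  rw [← symplFourierCLM_symplFourierCLM h, sub_eq_zero.1 hD, symplFourierCLM_symplFourierCLM]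

/-! ### The expansion of the Weyl product -/

theorem isOrder_of_eq_pow_smul {k : ℕ} {F G : ℝ → 𝓢(Phase d, ℂ)}
    (hG : ∀ a b : ℕ, ∃ C : ℝ, ∀ ε, SchwartzMap.seminorm ℝ a b (G ε) ≤ C)
    (h : ∀ ε ∈ Set.Ioo (0 : ℝ) 1, F ε = (ε : ℂ) ^ k • G ε) : IsOrder k F := by
  intro a b
  obtain ⟨C, hC⟩ := hG a b
  refine ⟨C, fun ε hε => ?_⟩
  have hs : (ε : ℂ) ^ k • G ε = ε ^ k • G ε := by
    ext X
    simp
  rw [h ε hε, hs, map_smul_eq_mul, Real.norm_of_nonneg (pow_nonneg hε.1.le k), mul_comm]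
  exact mul_le_mul_of_nonneg_right (hC ε) (pow_nonneg hε.1.le k)

theorem isOrder_weylProduct_sub_sum (N : ℕ) (f g : 𝓢(Phase d, ℂ)) :
    IsOrder (N + 1) fun ε => weylProduct ε f g -
      ∑ n ∈ Finset.range (N + 1), (ε : ℂ) ^ n • termSchwartz n f g :=
  isOrder_of_eq_pow_smul (exists_seminorm_remainderSchwartz_le N f g) fun ε hε => by
    rw [weylProduct_eq_sum_add N hε, add_sub_cancel_left]

theorem termSchwartz_zero_apply (f g : 𝓢(Phase d, ℂ)) (X : Phase d) :
    termSchwartz 0 f g X = f X * g X := by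
  simp [termSchwartz_apply, weylTerm]

theorem termSchwartz_one_apply (f g : 𝓢(Phase d, ℂ)) (X : Phase d) :
    termSchwartz 1 f g X = -(Complex.I / 2) * poisson f g X := by
  simp [termSchwartz_apply, weylTerm, biDiff_tensor]

end WeylCalculus

end

theorem mainTheorem1 (d : ℕ) (f g : 𝓢(WeylCalculus.Phase d, ℂ)) :
    ∃ (P : ℝ → 𝓢(WeylCalculus.Phase d, ℂ)) (T : ℕ → 𝓢(WeylCalculus.Phase d, ℂ))
      (R : ℕ → ℝ → 𝓢(WeylCalculus.Phase d, ℂ)),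
      -- `P ε` is the Weyl product of `f` and `g`
      (∀ ε ∈ Set.Ioo (0 : ℝ) 1, ∀ h : 𝓢(WeylCalculus.Phase d, ℂ),
        WeylCalculus.IsWeylProduct ε f g h ↔ h = P ε) ∧
      -- the terms and the remainders are explicit Schwartz functions
      (∀ (n : ℕ) (X : WeylCalculus.Phase d), T n X = WeylCalculus.weylTerm n f g X) ∧
      (∀ (N : ℕ), ∀ ε ∈ Set.Ioo (0 : ℝ) 1, ∀ X : WeylCalculus.Phase d,
        R N ε X = WeylCalculus.weylRemainder N ε f g X) ∧
      -- the expansion, exactly and with an error of order `ε ^ (N + 1)`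
      (∀ (N : ℕ), ∀ ε ∈ Set.Ioo (0 : ℝ) 1,
        P ε = (∑ n ∈ Finset.range (N + 1), (ε : ℂ) ^ n • T n) + (ε : ℂ) ^ (N + 1) • R N ε) ∧
      (∀ N : ℕ, WeylCalculus.IsOrder (N + 1)
        (fun ε => P ε - ∑ n ∈ Finset.range (N + 1), (ε : ℂ) ^ n • T n)) ∧
      -- the first two terms
      (∃ m b : 𝓢(WeylCalculus.Phase d, ℂ),
        (∀ X : WeylCalculus.Phase d, m X = f X * g X) ∧
        (∀ X : WeylCalculus.Phase d, b X = WeylCalculus.poisson f g X) ∧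
        WeylCalculus.IsOrder 2
          (fun ε => P ε - (m - ((ε : ℂ) * (Complex.I / 2)) • b))) := by
  refine ⟨fun ε => WeylCalculus.weylProduct ε f g, fun n => WeylCalculus.termSchwartz n f g,
    fun N ε => WeylCalculus.remainderSchwartz N ε f g, fun ε hε h => ⟨fun hh => ?_, ?_⟩,
    fun n X => WeylCalculus.termSchwartz_apply n f g X,
    fun N ε hε X => WeylCalculus.remainderSchwartz_apply N hε f g X,
    fun N ε hε => WeylCalculus.weylProduct_eq_sum_add N hε f g,
    fun N => WeylCalculus.isOrder_weylProduct_sub_sum N f g,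
    -- The first-order term is -(i/2){f, g}, so 2i times it is the bracket, which is thereby a
    -- Schwartz function.
    WeylCalculus.termSchwartz 0 f g, (2 * Complex.I) • WeylCalculus.termSchwartz 1 f g,
    WeylCalculus.termSchwartz_zero_apply f g, fun X => ?_, ?_⟩
  · exact hh.unique hε.1.ne' (WeylCalculus.isWeylProduct_weylProduct hε f g)
  · rintro rfl
    exact WeylCalculus.isWeylProduct_weylProduct hε f g
  · rw [smul_apply, smul_eq_mul, WeylCalculus.termSchwartz_one_apply]
    linear_combination -WeylCalculus.poisson f g X * Complex.I_sq
  · convert WeylCalculus.isOrder_weylProduct_sub_sum 1 f g using 3 with ε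
    rw [Finset.sum_range_succ, Finset.sum_range_one, pow_zero, one_smul, pow_one, smul_smul,
      sub_eq_add_neg, ← neg_smul]
    congr 2
    linear_combination -(ε : ℂ) * Complex.I_sq
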